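/- Let $d\ge 0$, $R>0$, $\lambda>0$ and $B(0,R)=\{x\in\mathbb{R}^d:\|x\|\le R\}$. Let $\mu_1,\dots,\mu_m$ and $\nu$ be Borel probability measures on $\mathbb{R}^d$ with supports contained in $B(0,R)$. For $\theta$ in the simplex $\Sigma_m=\{\theta\in\mathbb{R}_+^m:\sum_k\theta_k=1\}$ put $\mu_\theta=\sum_{k=1}^m\theta_k\mu_k$. A pair $(\varphi,\psi)\in L^\infty(\mu_\theta)\times L^\infty(\nu)$ is called a pair of dual potentials for $W_\lambda(\mu_\theta,\nu)$ if it maximizes the dual objective of entropic optimal transport $$(f,g)\mapsto\int f\,d\mu_\theta+\int g\,d\nu-\int\lambda\Big(e^{(f(x)+g(y)-\|x-y\|^2)/\lambda}-1\Big)\,d\mu_\theta(x)\,d\nu(y)$$ over $L^\infty(\mu_\theta)\times L^\infty(\nu)$. The regularized $c$-transform of $\varphi$ with respect to $\mu_\theta$ is $$\varphi^{c,\lambda}_{\mu_\theta}(y)=-\lambda\log\int e^{-(\|x-y\|^2-\varphi(x))/\lambda}\,d\mu_\theta(x),\qquad y\in B(0,R),$$ and $\|f\|_{\mathscr K}=\max_{|\kappa|\le\mathscr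 K}\sup_{y\in B(0,R)}|\partial^\kappa f(y)|$, with multi-indices $\kappa\in\mathbb{N}^d$. There are constants $M_{\mathscr K}>0$, $\mathscr K\in\mathbb{N}$, with $M_{\mathscr K}$ depending only on $\mathscr K$ (not on $d,m,R,\lambda,\mu_1,\dots,\mu_m,\nu,\theta$), such that in every situation as above and for every $\theta\in\Sigma_m$: 1. There is a pair $(\varphi,\psi)$ of dual potentials for $W_\lambda(\mu_\theta,\nu)$ with $\psi(0)=0$ and $\psi=\varphi^{c,\lambda}_{\mu_\theta}$ on $B(0,R)$. 2. For every such pair, $\psi$ is $C^\infty$ on $B(0,R)$, and for every integer $\mathscr K\ge 1$, $$\|\psi\|_{\mathscr K}\le M_{\mathscr K}\max\Big(R^2,\frac{R^{\mathscr K}}{\lambda^{\mathscr K-1}}\Big),$$ provided, in case $\mathscr K\ge 2$, that $R^2\ge\min(1,\lambda)$. -/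

import Mathlib

open MeasureTheory Metric
open scoped ENNReal ContDiff

namespace EntropicOT

/-- The re-weighted mixture `μ_θ = ∑ k, θ k • μ k`. -/
noncomputable def mixture {d m : ℕ} (μ : Fin m → Measure (EuclideanSpace ℝ (Fin d)))
    (θ : Fin m → ℝ) : Measure (EuclideanSpace ℝ (Fin d)) :=
  ∑ k, ENNReal.ofReal (θ k) • μ k

/-- The objective of the dual problem of entropic optimal transport, for the quadratic cost and
`0 < lam`:
`∫ φ dμ + ∫ ψ dν - ∫ lam * (exp ((φ x + ψ y - ‖x - y‖²) / lam) - 1) d(μ ⊗ ν)`. -/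
noncomputable def dualObjective {d : ℕ} (lam : ℝ) (μ ν : Measure (EuclideanSpace ℝ (Fin d)))
    (φ ψ : EuclideanSpace ℝ (Fin d) → ℝ) : ℝ :=
  ∫ x, φ x ∂μ + ∫ y, ψ y ∂ν
    - ∫ z, lam * (Real.exp ((φ z.1 + ψ z.2 - ‖z.1 - z.2‖ ^ 2) / lam) - 1) ∂(μ.prod ν)

/-- `(φ, ψ)` is a pair of (entropic) Kantorovich potentials for `W_lam(μ, ν)`: a solution of the
dual problem, i.e. a maximizer of the dual objective over `L^∞(μ) × L^∞(ν)`. -/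
structure IsDualPotentials {d : ℕ} (lam : ℝ) (μ ν : Measure (EuclideanSpace ℝ (Fin d)))
    (φ ψ : EuclideanSpace ℝ (Fin d) → ℝ) : Prop where
  memLp_left : MemLp φ ∞ μ
  memLp_right : MemLp ψ ∞ ν
  isMax : ∀ f g : EuclideanSpace ℝ (Fin d) → ℝ, MemLp f ∞ μ → MemLp g ∞ ν →
    dualObjective lam μ ν f g ≤ dualObjective lam μ ν φ ψ

/-- The regularized `c`-transform of `φ` with respect to `μ`, for the quadratic cost. -/
noncomputable def cTransform {d : ℕ} (lam : ℝ) (μ : Measure (EuclideanSpace ℝ (Fin d)))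
    (φ : EuclideanSpace ℝ (Fin d) → ℝ) (y : EuclideanSpace ℝ (Fin d)) : ℝ :=
  -lam * Real.log (∫ x, Real.exp (-(‖x - y‖ ^ 2 - φ x) / lam) ∂μ)

/-- The `i`-th partial derivative of `f` on the set `s` (taken within `s`, so that it makes sense up
to the boundary of a closed ball). -/
noncomputable def partialWithin {d : ℕ} (s : Set (EuclideanSpace ℝ (Fin d))) (i : Fin d)
    (f : EuclideanSpace ℝ (Fin d) → ℝ) (y : EuclideanSpace ℝ (Fin d)) : ℝ :=
  fderivWithin ℝ f s y (EuclideanSpace.single i 1)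

/-- The iterated partial derivative `∂^κ f = ∂₁^{κ₁} ⋯ ∂_d^{κ_d} f` on the set `s`. -/
noncomputable def multiPartialWithin {d : ℕ} (s : Set (EuclideanSpace ℝ (Fin d)))
    (κ : Fin d → ℕ) (f : EuclideanSpace ℝ (Fin d) → ℝ) : EuclideanSpace ℝ (Fin d) → ℝ :=
  (List.finRange d).foldr (fun i g => (partialWithin s i)^[κ i] g) f

/-- The norm `‖f‖_K = max_{|κ| ≤ K} sup_{y ∈ s} |∂^κ f y|`, with values in `[0, ∞]`. -/
noncomputable def ckNorm {d : ℕ} (s : Set (EuclideanSpace ℝ (Fin d))) (K : ℕ)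
    (f : EuclideanSpace ℝ (Fin d) → ℝ) : ℝ≥0∞ :=
  ⨆ (κ : Fin d → ℕ) (_ : ∑ i, κ i ≤ K) (y ∈ s), ‖multiPartialWithin s κ f y‖ₑ

end EntropicOT

/-!
Expanding the square in the cost turns the regularized `c`-transform into `‖y‖²` minus `lam` times
the log-Laplace transform of the random linear form `y ↦ 2 ⟪x, y⟫ / lam`, which is bounded by
`2 * R / lam`. Derivatives of a log-Laplace transform are Gibbs means, and the derivative of a Gibbs
mean is a covariance, i.e. a difference of Gibbs means and of products of Gibbs means; by induction,
the `n`-th derivative of the Gibbs mean of `h` is at most `n! * (2 * B) ^ n * ‖h‖_∞` for a linear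
form bounded by `B`. With `B = 2 * R / lam` this is the scale `R ^ (n + 1) / lam ^ n`, which is
geometric in `n`, so that only the lowest and the highest order matter.

For existence, maximizing the dual objective over the first potential leaves a functional of the
second one, the semi-dual, which a double `c`-transform can only increase. A `c`-transform is
`4 * R`-Lipschitz on the ball, and the semi-dual is invariant under adding constants, so it suffices
to maximize over Lipschitz functions vanishing at the origin: a compact set by Arzelà–Ascoli.
-/

namespace EntropicOT

section LogLaplace

variable {Ω : Type*} [MeasurableSpace Ω] {E : Type*} [NormedAddCommGroup E] [NormedSpace ℝ E]
  {F : Type*} [NormedAddCommGroup F] [NormedSpace ℝ F]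
  {ρ : Measure Ω} {L : Ω → E →L[ℝ] ℝ} {h : Ω → F} {B H : ℝ}

/-- The log-Laplace transform `y ↦ log ∫ exp (L s y) dρ(s)` of a random linear form `L`, i.e. its
cumulant generating function. -/
noncomputable def logLaplace (ρ : Measure Ω) (L : Ω → E →L[ℝ] ℝ) (y : E) : ℝ :=
  Real.log (∫ s, Real.exp (L s y) ∂ρ)

/-- The mean of `h` under the Gibbs measure proportional to `exp (L s y) dρ(s)`, as a function of
the parameter `y`. Taking `h = L` gives the gradient of `logLaplace ρ L`. -/
noncomputable def tiltedMean (ρ : Measure Ω) (L : Ω → E →L[ℝ] ℝ) (h : Ω → F) (y : E) : F :=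
  ∫ s, h s ∂ρ.tilted fun s => L s y

theorem tiltedMean_eq_inv_smul (ρ : Measure Ω) (L : Ω → E →L[ℝ] ℝ) (h : Ω → F) (y : E) :
    tiltedMean ρ L h y = (∫ s, Real.exp (L s y) ∂ρ)⁻¹ • ∫ s, Real.exp (L s y) • h s ∂ρ := by
  simp_rw [tiltedMean, integral_tilted, div_eq_inv_mul, mul_smul, integral_smul]

theorem aestronglyMeasurable_exp_apply (hL : AEStronglyMeasurable L ρ) (y : E) :
    AEStronglyMeasurable (fun s => Real.exp (L s y)) ρ :=
  Real.continuous_exp.comp_aestronglyMeasurable (hL.apply_continuousLinearMap y)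

theorem exp_apply_le {l : E →L[ℝ] ℝ} (hl : ‖l‖ ≤ B) (y : E) :
    Real.exp (l y) ≤ Real.exp (B * ‖y‖) :=
  Real.exp_le_exp.2 ((le_abs_self _).trans (l.le_of_opNorm_le hl y))

theorem integrable_exp_apply_smul [IsFiniteMeasure ρ] (hL : AEStronglyMeasurable L ρ)
    (hB : ∀ᵐ s ∂ρ, ‖L s‖ ≤ B) (hh : AEStronglyMeasurable h ρ) (hH : ∀ᵐ s ∂ρ, ‖h s‖ ≤ H) (y : E) :
    Integrable (fun s => Real.exp (L s y) • h s) ρ := by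
  refine Integrable.of_bound ((aestronglyMeasurable_exp_apply hL y).smul hh)
    (Real.exp (B * ‖y‖) * H) ?_
  filter_upwards [hB, hH] with s hLs hhs
  rw [norm_smul, Real.norm_of_nonneg (Real.exp_pos _).le]
  exact mul_le_mul (exp_apply_le hLs y) hhs (norm_nonneg _) (Real.exp_pos _).le

theorem integrable_exp_apply [IsFiniteMeasure ρ] (hL : AEStronglyMeasurable L ρ)
    (hB : ∀ᵐ s ∂ρ, ‖L s‖ ≤ B) (y : E) : Integrable (fun s => Real.exp (L s y)) ρ :=
  .of_bound (aestronglyMeasurable_exp_apply hL y) (Real.exp (B * ‖y‖)) <| by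
    filter_upwards [hB] with s hLs
    simpa only [Real.norm_of_nonneg (Real.exp_pos _).le] using exp_apply_le hLs y

theorem aestronglyMeasurable_smulRight (hL : AEStronglyMeasurable L ρ)
    (hh : AEStronglyMeasurable h ρ) :
    AEStronglyMeasurable (fun s => (L s).smulRight (h s)) ρ :=
  (ContinuousLinearMap.smulRightL ℝ E F).aestronglyMeasurable_comp₂ hL hh

theorem ae_norm_smulRight_le (hB : ∀ᵐ s ∂ρ, ‖L s‖ ≤ B) (hH : ∀ᵐ s ∂ρ, ‖h s‖ ≤ H) :
    ∀ᵐ s ∂ρ, ‖(L s).smulRight (h s)‖ ≤ B * H := by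
  filter_upwards [hB, hH] with s hLs hhs
  rw [ContinuousLinearMap.norm_smulRight_apply]
  exact mul_le_mul hLs hhs (norm_nonneg _) ((norm_nonneg _).trans hLs)

theorem hasFDerivAt_integral_exp_apply_smul [IsFiniteMeasure ρ] (hL : AEStronglyMeasurable L ρ)
    (hB : ∀ᵐ s ∂ρ, ‖L s‖ ≤ B) (hh : AEStronglyMeasurable h ρ) (hH : ∀ᵐ s ∂ρ, ‖h s‖ ≤ H) (y : E) :
    HasFDerivAt (fun y => ∫ s, Real.exp (L s y) • h s ∂ρ)
      (∫ s, Real.exp (L s y) • (L s).smulRight (h s) ∂ρ) y := by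
  refine hasFDerivAt_integral_of_dominated_of_fderiv_le
    (bound := fun _ => Real.exp (B * (‖y‖ + 1)) * (B * H))
    (F' := fun z s => Real.exp (L s z) • (L s).smulRight (h s))
    (ball_mem_nhds y one_pos)
    (.of_forall fun z => (aestronglyMeasurable_exp_apply hL z).smul hh)
    (integrable_exp_apply_smul hL hB hh hH y)
    ((aestronglyMeasurable_exp_apply hL y).smul (aestronglyMeasurable_smulRight hL hh))
    ?_ (integrable_const _) (.of_forall fun s z _ => ?_)
  · filter_upwards [ae_norm_smulRight_le hB hH, hB] with s hLhs hLs z hz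
    have hz' : ‖z‖ ≤ ‖y‖ + 1 := by
      linarith [norm_le_norm_add_norm_sub' z y, (mem_ball_iff_norm.1 hz).le]
    have hB0 : 0 ≤ B := (norm_nonneg _).trans hLs
    rw [norm_smul, Real.norm_of_nonneg (Real.exp_pos _).le]
    refine mul_le_mul ((exp_apply_le hLs z).trans ?_) hLhs (norm_nonneg _) (Real.exp_pos _).le
    gcongr
  · have exp_deriv : HasFDerivAt (fun y => Real.exp (L s y)) (Real.exp (L s z) • L s) z :=
      (L s).hasFDerivAt.exp
    convert! exp_deriv.smul_const (h s) using 1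
    ext v
    simp [smul_smul]

theorem hasFDerivAt_integral_exp_apply [IsFiniteMeasure ρ] (hL : AEStronglyMeasurable L ρ)
    (hB : ∀ᵐ s ∂ρ, ‖L s‖ ≤ B) (y : E) :
    HasFDerivAt (fun y => ∫ s, Real.exp (L s y) ∂ρ) (∫ s, Real.exp (L s y) • L s ∂ρ) y := by
  have smulRight_one (l : E →L[ℝ] ℝ) : l.smulRight (1 : ℝ) = l := by ext; simp
  simpa only [smul_eq_mul, mul_one, smulRight_one] using
    hasFDerivAt_integral_exp_apply_smul hL hB (h := fun _ => (1 : ℝ)) (H := 1)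
      aestronglyMeasurable_const (by simp) y

theorem hasFDerivAt_logLaplace [IsFiniteMeasure ρ] [NeZero ρ] (hL : AEStronglyMeasurable L ρ)
    (hB : ∀ᵐ s ∂ρ, ‖L s‖ ≤ B) (y : E) :
    HasFDerivAt (logLaplace ρ L) (tiltedMean ρ L L y) y := by
  rw [tiltedMean_eq_inv_smul]
  exact (hasFDerivAt_integral_exp_apply hL hB y).log
    (integral_exp_pos (integrable_exp_apply hL hB y)).ne'

theorem hasFDerivAt_tiltedMean [IsFiniteMeasure ρ] [NeZero ρ] (hL : AEStronglyMeasurable L ρ)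
    (hB : ∀ᵐ s ∂ρ, ‖L s‖ ≤ B) (hh : AEStronglyMeasurable h ρ) (hH : ∀ᵐ s ∂ρ, ‖h s‖ ≤ H) (y : E) :
    HasFDerivAt (tiltedMean ρ L h)
      (tiltedMean ρ L (fun s => (L s).smulRight (h s)) y -
        (tiltedMean ρ L L y).smulRight (tiltedMean ρ L h y)) y := by
  have hZ : ∫ s, Real.exp (L s y) ∂ρ ≠ 0 := (integral_exp_pos (integrable_exp_apply hL hB y)).ne'
  rw [funext (tiltedMean_eq_inv_smul ρ L h)]
  convert! ((hasDerivAt_inv hZ).comp_hasFDerivAt y (hasFDerivAt_integral_exp_apply hL hB y)).smul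
    (hasFDerivAt_integral_exp_apply_smul hL hB hh hH y) using 1
  ext v
  simp only [tiltedMean_eq_inv_smul, sub_apply, add_apply, smul_apply,
    ContinuousLinearMap.smulRight_apply, smul_eq_mul, Function.comp_apply, smul_smul]
  rw [sub_eq_add_neg, ← neg_smul]
  congr 2
  ring

theorem norm_tiltedMean_le [IsFiniteMeasure ρ] [NeZero ρ] (hL : AEStronglyMeasurable L ρ)
    (hB : ∀ᵐ s ∂ρ, ‖L s‖ ≤ B) (hH : ∀ᵐ s ∂ρ, ‖h s‖ ≤ H) (y : E) :
    ‖tiltedMean ρ L h y‖ ≤ H := by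
  have := isProbabilityMeasure_tilted (integrable_exp_apply hL hB y)
  simpa [tiltedMean] using norm_integral_le_of_norm_le_const
    ((tilted_absolutelyContinuous ρ fun s => L s y).ae_le hH)

theorem norm_iteratedFDeriv_smulRight_le {f : E → E →L[ℝ] ℝ} {g : E → F} {A a b : ℝ} {n : ℕ}
    (hf : ContDiff ℝ n f) (hg : ContDiff ℝ n g) {y : E}
    (hfb : ∀ i ≤ n, ‖iteratedFDeriv ℝ i f y‖ ≤ i.factorial * A ^ i * a)
    (hgb : ∀ i ≤ n, ‖iteratedFDeriv ℝ i g y‖ ≤ i.factorial * A ^ i * b) :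
    ‖iteratedFDeriv ℝ n (fun y => (f y).smulRight (g y)) y‖ ≤
      (n + 1).factorial * A ^ n * (a * b) := by
  refine ((ContinuousLinearMap.smulRightL ℝ E F).norm_iteratedFDeriv_le_of_bilinear_of_le_one
    hf hg y le_rfl ContinuousLinearMap.norm_smulRightL_le).trans ?_
  have summand_le (i : ℕ) (hi : i ∈ Finset.range (n + 1)) :
      (n.choose i : ℝ) * ‖iteratedFDeriv ℝ i f y‖ * ‖iteratedFDeriv ℝ (n - i) g y‖ ≤
        n.factorial * A ^ n * (a * b) := by
    have hin : i ≤ n := Nat.lt_succ_iff.1 (Finset.mem_range.1 hi)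
    calc (n.choose i : ℝ) * ‖iteratedFDeriv ℝ i f y‖ * ‖iteratedFDeriv ℝ (n - i) g y‖
        ≤ n.choose i * (i.factorial * A ^ i * a) * ((n - i).factorial * A ^ (n - i) * b) := by
          have := (norm_nonneg _).trans (hfb i hin)
          gcongr
          exacts [hfb i hin, hgb _ (n.sub_le i)]
      _ = (n.choose i * i.factorial * (n - i).factorial : ℕ) * (A ^ i * A ^ (n - i)) * (a * b) := by
          push_cast; ring
      _ = n.factorial * A ^ n * (a * b) := by
          rw [Nat.choose_mul_factorial_mul_factorial hin, ← pow_add, Nat.add_sub_cancel' hin]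
  calc _ ≤ ∑ _i ∈ Finset.range (n + 1), (n.factorial : ℝ) * A ^ n * (a * b) :=
        Finset.sum_le_sum summand_le
    _ = (n + 1).factorial * A ^ n * (a * b) := by
        rw [Finset.sum_const, Finset.card_range, nsmul_eq_mul, Nat.factorial_succ]
        push_cast; ring

end LogLaplace

section LogLaplaceSmooth

-- `E` and `F` share a universe because the inductions below replace `F` by `E →L[ℝ] F`.
universe u

variable {Ω : Type*} [MeasurableSpace Ω] {E : Type u} [NormedAddCommGroup E] [NormedSpace ℝ E]
  {F : Type u} [NormedAddCommGroup F] [NormedSpace ℝ F]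
  {ρ : Measure Ω} {L : Ω → E →L[ℝ] ℝ} {h : Ω → F} {B H : ℝ}

theorem contDiff_tiltedMean [IsFiniteMeasure ρ] [NeZero ρ] (hL : AEStronglyMeasurable L ρ)
    (hB : ∀ᵐ s ∂ρ, ‖L s‖ ≤ B) (hh : AEStronglyMeasurable h ρ) (hH : ∀ᵐ s ∂ρ, ‖h s‖ ≤ H) :
    ContDiff ℝ ∞ (tiltedMean ρ L h) := by
  refine contDiff_infty.2 fun n => ?_
  induction n generalizing F H with
  | zero =>
    rw [Nat.cast_zero, contDiff_zero, continuous_iff_continuousAt]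
    exact fun y => (hasFDerivAt_tiltedMean hL hB hh hH y).continuousAt
  | succ n ih =>
    rw [Nat.cast_succ, contDiff_succ_iff_fderiv]
    refine ⟨fun y => (hasFDerivAt_tiltedMean hL hB hh hH y).differentiableAt, by simp, ?_⟩
    rw [funext fun y => (hasFDerivAt_tiltedMean hL hB hh hH y).fderiv]
    exact (ih (aestronglyMeasurable_smulRight hL hh) (ae_norm_smulRight_le hB hH)).sub
      ((ih hL hB).smulRight (ih hh hH))

theorem contDiff_logLaplace [IsFiniteMeasure ρ] [NeZero ρ] (hL : AEStronglyMeasurable L ρ)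
    (hB : ∀ᵐ s ∂ρ, ‖L s‖ ≤ B) : ContDiff ℝ ∞ (logLaplace ρ L) := by
  refine contDiff_infty_iff_fderiv.2
    ⟨fun y => (hasFDerivAt_logLaplace hL hB y).differentiableAt, ?_⟩
  rw [funext fun y => (hasFDerivAt_logLaplace hL hB y).fderiv]
  exact contDiff_tiltedMean hL hB hL hB

theorem norm_iteratedFDeriv_tiltedMean_le [IsFiniteMeasure ρ] [NeZero ρ]
    (hL : AEStronglyMeasurable L ρ) (hB : ∀ᵐ s ∂ρ, ‖L s‖ ≤ B) (hh : AEStronglyMeasurable h ρ)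
    (hH : ∀ᵐ s ∂ρ, ‖h s‖ ≤ H) (n : ℕ) (y : E) :
    ‖iteratedFDeriv ℝ n (tiltedMean ρ L h) y‖ ≤ n.factorial * (2 * B) ^ n * H := by
  obtain ⟨s, hLs, hhs⟩ := (hB.and hH).exists
  have hB0 : 0 ≤ B := (norm_nonneg _).trans hLs
  have hH0 : 0 ≤ H := (norm_nonneg _).trans hhs
  clear s hLs hhs
  induction n using Nat.strong_induction_on generalizing F H with
  | _ n ih =>
  cases n with
  | zero => simpa using norm_tiltedMean_le hL hB hH y
  | succ n =>
    have hLh := aestronglyMeasurable_smulRight hL hh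
    have hBH := ae_norm_smulRight_le hB hH
    have moment_smooth := (contDiff_tiltedMean hL hB hLh hBH).of_le
      (mod_cast le_top : (n : ℕ∞ω) ≤ (∞ : ℕ∞ω))
    have L_smooth := (contDiff_tiltedMean hL hB hL hB).of_le
      (mod_cast le_top : (n : ℕ∞ω) ≤ (∞ : ℕ∞ω))
    have h_smooth := (contDiff_tiltedMean hL hB hh hH).of_le
      (mod_cast le_top : (n : ℕ∞ω) ≤ (∞ : ℕ∞ω))
    rw [← norm_iteratedFDeriv_fderiv,
      funext fun y => (hasFDerivAt_tiltedMean hL hB hh hH y).fderiv,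
      fun_iteratedFDeriv_sub moment_smooth (L_smooth.smulRight h_smooth)]
    calc _ ≤ n.factorial * (2 * B) ^ n * (B * H) + (n + 1).factorial * (2 * B) ^ n * (B * H) :=
          (norm_sub_le _ _).trans (add_le_add (ih n n.lt_succ_self hLh hBH (by positivity))
            (norm_iteratedFDeriv_smulRight_le L_smooth h_smooth
              (fun i hi => ih i (Nat.lt_succ_of_le hi) hL hB hB0)
              (fun i hi => ih i (Nat.lt_succ_of_le hi) hh hH hH0)))
      _ ≤ (n + 1).factorial * (2 * B) ^ n * (B * H) +
          (n + 1).factorial * (2 * B) ^ n * (B * H) := by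
          gcongr
          exact n.le_succ
      _ = (n + 1).factorial * (2 * B) ^ (n + 1) * H := by ring

end LogLaplaceSmooth

section CTransform

variable {d : ℕ} {R lam : ℝ} {μ : Measure (EuclideanSpace ℝ (Fin d))}
  {φ : EuclideanSpace ℝ (Fin d) → ℝ}

theorem exp_cost_eq_mul (lam : ℝ) (φ : EuclideanSpace ℝ (Fin d) → ℝ)
    (x y : EuclideanSpace ℝ (Fin d)) :
    Real.exp (-(‖x - y‖ ^ 2 - φ x) / lam) =
      Real.exp (-‖x - y‖ ^ 2 / lam) * Real.exp (φ x / lam) := by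
  rw [← Real.exp_add]
  ring_nf

theorem integrable_exp_cost (hlam : 0 < lam) (hφ : Integrable (fun x => Real.exp (φ x / lam)) μ)
    (y : EuclideanSpace ℝ (Fin d)) :
    Integrable (fun x => Real.exp (-(‖x - y‖ ^ 2 - φ x) / lam)) μ := by
  simp_rw [exp_cost_eq_mul]
  refine hφ.bdd_mul (c := 1) (by fun_prop) (.of_forall fun x => ?_)
  rw [Real.norm_of_nonneg (Real.exp_pos _).le, Real.exp_le_one_iff, neg_div, neg_nonpos]
  positivity

/-- The linear form `y ↦ 2 ⟪x, y⟫ / lam`, the cross term of the cost `‖x - y‖² / lam`. -/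
noncomputable def crossTerm (lam : ℝ) (x : EuclideanSpace ℝ (Fin d)) :
    EuclideanSpace ℝ (Fin d) →L[ℝ] ℝ :=
  (2 / lam) • innerSL ℝ x

/-- The exponent in the `c`-transform of `φ` at `y = 0`: by expanding the square in the cost, the
`c`-transform becomes the log-Laplace transform of `crossTerm` for the measure `μ` tilted by this
weight. -/
noncomputable def costWeight (lam : ℝ) (φ : EuclideanSpace ℝ (Fin d) → ℝ)
    (x : EuclideanSpace ℝ (Fin d)) : ℝ :=
  -(‖x‖ ^ 2 - φ x) / lam

theorem integrable_exp_costWeight (hlam : 0 < lam)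
    (hφ : Integrable (fun x => Real.exp (φ x / lam)) μ) :
    Integrable (fun x => Real.exp (costWeight lam φ x)) μ := by
  simpa [costWeight] using integrable_exp_cost hlam hφ 0

theorem aestronglyMeasurable_crossTerm (lam : ℝ) (μ : Measure (EuclideanSpace ℝ (Fin d))) :
    AEStronglyMeasurable (crossTerm lam) μ :=
  ((innerSL ℝ).continuous.const_smul (2 / lam)).aestronglyMeasurable

theorem ae_norm_crossTerm_le (hlam : 0 < lam) (hμ : ∀ᵐ x ∂μ, ‖x‖ ≤ R)
    (φ : EuclideanSpace ℝ (Fin d) → ℝ) :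
    ∀ᵐ x ∂μ.tilted (costWeight lam φ), ‖crossTerm lam x‖ ≤ 2 * R / lam := by
  filter_upwards [tilted_absolutelyContinuous μ _ hμ] with x hx
  rw [crossTerm, norm_smul, innerSL_apply_norm, Real.norm_of_nonneg (by positivity),
    div_mul_eq_mul_div]
  gcongr

theorem exp_cost_eq_exp_costWeight (hlam : 0 < lam) (φ : EuclideanSpace ℝ (Fin d) → ℝ)
    (x y : EuclideanSpace ℝ (Fin d)) :
    Real.exp (-(‖x - y‖ ^ 2 - φ x) / lam) =
      Real.exp (-‖y‖ ^ 2 / lam) * Real.exp (costWeight lam φ x + crossTerm lam x y) := by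
  rw [← Real.exp_add, costWeight, crossTerm, norm_sub_sq_real, smul_apply, innerSL_apply_apply,
    smul_eq_mul]
  congr 1
  field_simp
  ring

variable [NeZero μ]

theorem cTransform_eq_sub_logLaplace (hlam : 0 < lam) (hμ : ∀ᵐ x ∂μ, ‖x‖ ≤ R)
    (hφ : Integrable (fun x => Real.exp (φ x / lam)) μ) (y : EuclideanSpace ℝ (Fin d)) :
    cTransform lam μ φ y = ‖y‖ ^ 2 - lam * Real.log (∫ x, Real.exp (costWeight lam φ x) ∂μ) -
      lam * logLaplace (μ.tilted (costWeight lam φ)) (crossTerm lam) y := by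
  have hw := integrable_exp_costWeight hlam hφ
  have := isProbabilityMeasure_tilted hw
  have hZ := (integral_exp_pos hw).ne'
  have hlaplace := (integral_exp_pos (integrable_exp_apply (aestronglyMeasurable_crossTerm lam _)
    (ae_norm_crossTerm_le hlam hμ φ) y)).ne'
  have factor : ∫ x, Real.exp (-(‖x - y‖ ^ 2 - φ x) / lam) ∂μ = Real.exp (-‖y‖ ^ 2 / lam) *
      ((∫ x, Real.exp (costWeight lam φ x) ∂μ) *
        ∫ x, Real.exp (crossTerm lam x y) ∂μ.tilted (costWeight lam φ)) := by
    rw [integral_exp_tilted, mul_div_cancel₀ _ hZ, ← integral_const_mul]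
    simp only [exp_cost_eq_exp_costWeight hlam, Pi.add_apply]
  rw [cTransform, factor, Real.log_mul (Real.exp_ne_zero _) (mul_ne_zero hZ hlaplace),
    Real.log_mul hZ hlaplace, Real.log_exp, logLaplace]
  field_simp
  ring

theorem hasFDerivAt_cTransform (hlam : 0 < lam) (hμ : ∀ᵐ x ∂μ, ‖x‖ ≤ R)
    (hφ : Integrable (fun x => Real.exp (φ x / lam)) μ) (y : EuclideanSpace ℝ (Fin d)) :
    HasFDerivAt (cTransform lam μ φ)
      (((2 : ℝ) • innerSL ℝ : _ →L[ℝ] _ →L[ℝ] ℝ) y - lam •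
        tiltedMean (μ.tilted (costWeight lam φ)) (crossTerm lam) (crossTerm lam) y) y := by
  have := isProbabilityMeasure_tilted (integrable_exp_costWeight hlam hφ)
  rw [funext (cTransform_eq_sub_logLaplace hlam hμ hφ)]
  convert! ((hasStrictFDerivAt_norm_sq y).hasFDerivAt.sub_const _).sub
    ((hasFDerivAt_logLaplace (aestronglyMeasurable_crossTerm lam _)
      (ae_norm_crossTerm_le hlam hμ φ) y).const_mul lam) using 1
  ext v
  simp [two_smul]

theorem contDiff_cTransform (hlam : 0 < lam) (hμ : ∀ᵐ x ∂μ, ‖x‖ ≤ R)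
    (hφ : Integrable (fun x => Real.exp (φ x / lam)) μ) : ContDiff ℝ ∞ (cTransform lam μ φ) := by
  have := isProbabilityMeasure_tilted (integrable_exp_costWeight hlam hφ)
  rw [funext (cTransform_eq_sub_logLaplace hlam hμ hφ)]
  exact ((contDiff_norm_sq ℝ).sub contDiff_const).sub (contDiff_const.mul
    (contDiff_logLaplace (aestronglyMeasurable_crossTerm lam _) (ae_norm_crossTerm_le hlam hμ φ)))

theorem norm_iteratedFDeriv_tiltedMean_crossTerm_le (hlam : 0 < lam) (hμ : ∀ᵐ x ∂μ, ‖x‖ ≤ R)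
    (hφ : Integrable (fun x => Real.exp (φ x / lam)) μ) (n : ℕ) (y : EuclideanSpace ℝ (Fin d)) :
    ‖iteratedFDeriv ℝ n (fun y => lam •
        tiltedMean (μ.tilted (costWeight lam φ)) (crossTerm lam) (crossTerm lam) y) y‖ ≤
      2 * n.factorial * 4 ^ n * (R ^ (n + 1) / lam ^ n) := by
  have := isProbabilityMeasure_tilted (integrable_exp_costWeight hlam hφ)
  have hL := aestronglyMeasurable_crossTerm lam (μ.tilted (costWeight lam φ))
  have hB := ae_norm_crossTerm_le hlam hμ φ
  have smooth := (contDiff_tiltedMean hL hB hL hB).of_le (mod_cast le_top : (n : ℕ∞ω) ≤ (∞ : ℕ∞ω))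
  rw [iteratedFDeriv_const_smul_apply' smooth.contDiffAt, norm_smul, Real.norm_of_nonneg hlam.le]
  calc _ ≤ lam * (n.factorial * (2 * (2 * R / lam)) ^ n * (2 * R / lam)) := by
        gcongr
        exact norm_iteratedFDeriv_tiltedMean_le hL hB hL hB n y
    _ = 2 * n.factorial * 4 ^ n * (R ^ (n + 1) / lam ^ n) := by
        rw [show 2 * (2 * R / lam) = 4 * (R / lam) by ring, mul_pow, div_pow]
        field_simp
        ring

theorem norm_iteratedFDeriv_succ_clm_le {E F : Type*} [NormedAddCommGroup E] [NormedSpace ℝ E]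
    [NormedAddCommGroup F] [NormedSpace ℝ F] (l : E →L[ℝ] F) (n : ℕ) (y : E) :
    ‖iteratedFDeriv ℝ (n + 1) l y‖ ≤ ‖l‖ := by
  rw [← norm_iteratedFDeriv_fderiv, (funext fun y => l.fderiv : fderiv ℝ l = fun _ => l)]
  cases n with
  | zero => rw [norm_iteratedFDeriv_zero]
  | succ n => simp [iteratedFDeriv_const_of_ne n.succ_ne_zero]

theorem norm_two_smul_innerSL_le :
    ‖((2 : ℝ) • innerSL ℝ : EuclideanSpace ℝ (Fin d) →L[ℝ] _ →L[ℝ] ℝ)‖ ≤ 2 :=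
  ContinuousLinearMap.opNorm_le_bound _ zero_le_two fun x => by
    rw [smul_apply, norm_smul, innerSL_apply_norm, Real.norm_of_nonneg zero_le_two]

theorem norm_fderiv_cTransform_le (hlam : 0 < lam) (hμ : ∀ᵐ x ∂μ, ‖x‖ ≤ R)
    (hφ : Integrable (fun x => Real.exp (φ x / lam)) μ) {y : EuclideanSpace ℝ (Fin d)}
    (hy : ‖y‖ ≤ R) : ‖fderiv ℝ (cTransform lam μ φ) y‖ ≤ 4 * R := by
  have hquad := ContinuousLinearMap.le_of_opNorm_le_of_le _ norm_two_smul_innerSL_le hy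
  have hmean := norm_iteratedFDeriv_tiltedMean_crossTerm_le hlam hμ hφ 0 y
  rw [norm_iteratedFDeriv_zero] at hmean
  rw [(hasFDerivAt_cTransform hlam hμ hφ y).fderiv]
  calc _ ≤ 2 * R + 2 * R := (norm_sub_le _ _).trans (add_le_add hquad (by simpa using hmean))
    _ = 4 * R := by ring

theorem norm_iteratedFDeriv_cTransform_le (hlam : 0 < lam) (hμ : ∀ᵐ x ∂μ, ‖x‖ ≤ R)
    (hφ : Integrable (fun x => Real.exp (φ x / lam)) μ) (n : ℕ) (y : EuclideanSpace ℝ (Fin d)) :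
    ‖iteratedFDeriv ℝ (n + 2) (cTransform lam μ φ) y‖ ≤
      2 + 2 * (n + 1).factorial * 4 ^ (n + 1) * (R ^ (n + 2) / lam ^ (n + 1)) := by
  have := isProbabilityMeasure_tilted (integrable_exp_costWeight hlam hφ)
  have hL := aestronglyMeasurable_crossTerm lam (μ.tilted (costWeight lam φ))
  have hB := ae_norm_crossTerm_le hlam hμ φ
  have mean_smooth := ((contDiff_tiltedMean hL hB hL hB).const_smul lam).of_le
    (mod_cast le_top : ((n + 1 : ℕ) : ℕ∞ω) ≤ (∞ : ℕ∞ω))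
  rw [← norm_iteratedFDeriv_fderiv, funext fun y => (hasFDerivAt_cTransform hlam hμ hφ y).fderiv,
    fun_iteratedFDeriv_sub (ContinuousLinearMap.contDiff _) mean_smooth]
  exact (norm_sub_le _ _).trans (add_le_add
    ((norm_iteratedFDeriv_succ_clm_le _ n y).trans norm_two_smul_innerSL_le)
    (norm_iteratedFDeriv_tiltedMean_crossTerm_le hlam hμ hφ (n + 1) y))

theorem lipschitzOnWith_cTransform (hlam : 0 < lam) (hμ : ∀ᵐ x ∂μ, ‖x‖ ≤ R)
    (hφ : Integrable (fun x => Real.exp (φ x / lam)) μ) :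
    LipschitzOnWith (4 * R).toNNReal (cTransform lam μ φ) (closedBall 0 R) :=
  (convex_closedBall 0 R).lipschitzOnWith_of_nnnorm_fderiv_le
    (fun y _ => (hasFDerivAt_cTransform hlam hμ hφ y).differentiableAt) fun y hy => by
      rw [← NNReal.coe_le_coe, coe_nnnorm]
      exact (norm_fderiv_cTransform_le hlam hμ hφ (mem_closedBall_zero_iff.1 hy)).trans
        (Real.le_coe_toNNReal _)

end CTransform

section MultiPartial

variable {d : ℕ} {s : Set (EuclideanSpace ℝ (Fin d))} {f : EuclideanSpace ℝ (Fin d) → ℝ}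

theorem contDiffOn_partialWithin (hs : UniqueDiffOn ℝ s) (hf : ContDiffOn ℝ ∞ f s) (i : Fin d) :
    ContDiffOn ℝ ∞ (partialWithin s i f) s :=
  (hf.fderivWithin hs le_rfl).clm_apply contDiffOn_const

theorem norm_iteratedFDerivWithin_partialWithin_le (hs : UniqueDiffOn ℝ s)
    (hf : ContDiffOn ℝ ∞ f s) (i : Fin d) (n : ℕ) {y : EuclideanSpace ℝ (Fin d)} (hy : y ∈ s) :
    ‖iteratedFDerivWithin ℝ n (partialWithin s i f) s y‖ ≤
      ‖iteratedFDerivWithin ℝ (n + 1) f s y‖ := by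
  refine (norm_iteratedFDerivWithin_clm_apply_const (hf.fderivWithin hs le_rfl y hy) hs hy
    (mod_cast le_top : (n : ℕ∞ω) ≤ (∞ : ℕ∞ω))).trans_eq ?_
  rw [norm_iteratedFDerivWithin_fderivWithin hs hy, PiLp.norm_single, norm_one, one_mul]

theorem contDiffOn_iterate_partialWithin (hs : UniqueDiffOn ℝ s) (hf : ContDiffOn ℝ ∞ f s)
    (i : Fin d) (k : ℕ) : ContDiffOn ℝ ∞ ((partialWithin s i)^[k] f) s := by
  induction k with
  | zero => exact hf
  | succ k ih =>
    rw [Function.iterate_succ_apply']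
    exact contDiffOn_partialWithin hs ih i

theorem norm_iteratedFDerivWithin_iterate_partialWithin_le (hs : UniqueDiffOn ℝ s)
    (hf : ContDiffOn ℝ ∞ f s) (i : Fin d) (k n : ℕ) {y : EuclideanSpace ℝ (Fin d)} (hy : y ∈ s) :
    ‖iteratedFDerivWithin ℝ n ((partialWithin s i)^[k] f) s y‖ ≤
      ‖iteratedFDerivWithin ℝ (n + k) f s y‖ := by
  induction k generalizing n with
  | zero => rfl
  | succ k ih =>
    rw [Function.iterate_succ_apply', ← add_assoc, add_right_comm]
    exact (norm_iteratedFDerivWithin_partialWithin_le hs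
      (contDiffOn_iterate_partialWithin hs hf i k) i n hy).trans (ih (n + 1))

theorem norm_multiPartialWithin_le (hs : UniqueDiffOn ℝ s) (hf : ContDiffOn ℝ ∞ f s)
    (κ : Fin d → ℕ) {y : EuclideanSpace ℝ (Fin d)} (hy : y ∈ s) :
    ‖multiPartialWithin s κ f y‖ ≤ ‖iteratedFDerivWithin ℝ (∑ i, κ i) f s y‖ := by
  suffices key : ∀ l : List (Fin d),
      ContDiffOn ℝ ∞ (l.foldr (fun i g => (partialWithin s i)^[κ i] g) f) s ∧
      ∀ n, ‖iteratedFDerivWithin ℝ n (l.foldr (fun i g => (partialWithin s i)^[κ i] g) f) s y‖ ≤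
        ‖iteratedFDerivWithin ℝ (n + (l.map κ).sum) f s y‖ by
    have bound := (key (List.finRange d)).2 0
    rwa [norm_iteratedFDerivWithin_zero, zero_add, ← List.ofFn_eq_map, List.sum_ofFn] at bound
  intro l
  induction l with
  | nil => exact ⟨hf, fun n => le_rfl⟩
  | cons i l ih =>
    refine ⟨contDiffOn_iterate_partialWithin hs ih.1 i (κ i), fun n => ?_⟩
    rw [List.map_cons, List.sum_cons, ← add_assoc]
    exact (norm_iteratedFDerivWithin_iterate_partialWithin_le hs ih.1 i (κ i) n hy).trans
      (ih.2 (n + κ i))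

theorem ckNorm_le {K : ℕ} {C : ℝ} (hs : UniqueDiffOn ℝ s) (hf : ContDiffOn ℝ ∞ f s)
    (hC : ∀ n ≤ K, ∀ y ∈ s, ‖iteratedFDerivWithin ℝ n f s y‖ ≤ C) :
    ckNorm s K f ≤ ENNReal.ofReal C := by
  refine iSup₂_le fun κ hκ => iSup₂_le fun y hy => ?_
  rw [← ofReal_norm]
  exact ENNReal.ofReal_le_ofReal ((norm_multiPartialWithin_le hs hf κ hy).trans (hC _ hκ y hy))

end MultiPartial

section Bounds

variable {d : ℕ} {R lam : ℝ} {μ : Measure (EuclideanSpace ℝ (Fin d))} [NeZero μ]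
  {φ ψ : EuclideanSpace ℝ (Fin d) → ℝ} {K : ℕ}

theorem one_le_max_sq_pow_div_pow (hR : 0 < R) (hlam : 0 < lam) (h : min 1 lam ≤ R ^ 2)
    (hK : 2 ≤ K) : 1 ≤ max (R ^ 2) (R ^ K / lam ^ (K - 1)) := by
  rcases le_or_gt 1 (R ^ 2) with one_le | lt_one
  · exact one_le.trans (le_max_left _ _)
  · have hlamR : lam ≤ R ^ 2 := (min_le_iff.1 h).resolve_left (not_le.2 lt_one)
    have hR1 : R ≤ 1 := by nlinarith
    obtain ⟨k, rfl⟩ := Nat.exists_eq_add_of_le' hK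
    refine le_max_of_le_right ((one_le_div (by positivity)).2 ?_)
    calc lam ^ (k + 1) ≤ (R ^ 2) ^ (k + 1) := by gcongr
      _ = R ^ (k + 2) * R ^ k := by ring
      _ ≤ R ^ (k + 2) := mul_le_of_le_one_right (by positivity) (pow_le_one₀ hR.le hR1)

theorem le_max_sq_pow_div_pow (hR : 0 < R) (hlam : 0 < lam) (hK : 1 ≤ K)
    (h : K = 1 ∨ min 1 lam ≤ R ^ 2) : R ≤ max (R ^ 2) (R ^ K / lam ^ (K - 1)) := by
  rcases hK.eq_or_lt with rfl | hK
  · simp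
  · have one_le := one_le_max_sq_pow_div_pow hR hlam (h.resolve_left hK.ne') hK
    rcases le_total R 1 with hR1 | hR1
    · exact hR1.trans one_le
    · exact le_max_of_le_left (le_self_pow₀ hR1 two_ne_zero)

theorem pow_succ_div_pow_le_max (hR : 0 < R) (hlam : 0 < lam) {n k : ℕ} (hnk : n ≤ k) :
    R ^ (n + 1) / lam ^ n ≤ max R (R ^ (k + 1) / lam ^ k) := by
  have geometric (j : ℕ) : R ^ (j + 1) / lam ^ j = R * (R / lam) ^ j := by rw [div_pow]; ring
  rw [geometric, geometric]
  rcases le_total R lam with hle | hle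
  · exact le_max_of_le_left (mul_le_of_le_one_right hR.le
      (pow_le_one₀ (by positivity) ((div_le_one hlam).2 hle)))
  · refine le_max_of_le_right ?_
    gcongr
    exact (one_le_div hlam).2 hle

theorem abs_cTransform_le (hlam : 0 < lam) (hμ : ∀ᵐ x ∂μ, ‖x‖ ≤ R)
    (hφ : Integrable (fun x => Real.exp (φ x / lam)) μ) (h0 : cTransform lam μ φ 0 = 0)
    {y : EuclideanSpace ℝ (Fin d)} (hy : ‖y‖ ≤ R) : |cTransform lam μ φ y| ≤ 4 * R ^ 2 := by
  have hR : 0 ≤ R := (norm_nonneg y).trans hy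
  have lipschitz := (lipschitzOnWith_cTransform hlam hμ hφ).dist_le_mul y
    (mem_closedBall_zero_iff.2 hy) 0 (mem_closedBall_self hR)
  rw [Real.dist_eq, h0, sub_zero, dist_zero_right, Real.coe_toNNReal _ (by positivity)] at lipschitz
  calc |cTransform lam μ φ y| ≤ 4 * R * R := lipschitz.trans (by gcongr)
    _ = 4 * R ^ 2 := by ring

theorem norm_iteratedFDeriv_cTransform_le_max (hR : 0 < R) (hlam : 0 < lam)
    (hμ : ∀ᵐ x ∂μ, ‖x‖ ≤ R) (hφ : Integrable (fun x => Real.exp (φ x / lam)) μ)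
    (h0 : cTransform lam μ φ 0 = 0) (h : K = 1 ∨ min 1 lam ≤ R ^ 2) (hK : 1 ≤ K) {n : ℕ}
    (hn : n ≤ K) {y : EuclideanSpace ℝ (Fin d)} (hy : ‖y‖ ≤ R) :
    ‖iteratedFDeriv ℝ n (cTransform lam μ φ) y‖ ≤
      4 ^ K * K.factorial * max (R ^ 2) (R ^ K / lam ^ (K - 1)) := by
  set T := max (R ^ 2) (R ^ K / lam ^ (K - 1))
  have hRT : R ≤ T := le_max_sq_pow_div_pow hR hlam hK h
  have : 0 < T := hR.trans_le hRT
  have one_le_factorial : (1 : ℝ) ≤ K.factorial := mod_cast K.factorial_pos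
  have four_le : (4 : ℝ) ≤ 4 ^ K * K.factorial :=
    (le_self_pow₀ (by norm_num) (by omega)).trans
      (le_mul_of_one_le_right (by positivity) one_le_factorial)
  match n with
  | 0 =>
    rw [norm_iteratedFDeriv_zero, Real.norm_eq_abs]
    exact (abs_cTransform_le hlam hμ hφ h0 hy).trans
      (mul_le_mul four_le (le_max_left _ _) (by positivity) (by positivity))
  | 1 =>
    rw [norm_iteratedFDeriv_one]
    exact (norm_fderiv_cTransform_le hlam hμ hφ hy).trans
      (mul_le_mul four_le hRT hR.le (by positivity))
  | n + 2 =>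
    have one_le_T : 1 ≤ T :=
      one_le_max_sq_pow_div_pow hR hlam (h.resolve_left (by omega)) (by omega)
    have scale_le_T : R ^ (n + 2) / lam ^ (n + 1) ≤ T := by
      have := pow_succ_div_pow_le_max hR hlam (n := n + 1) (k := K - 1) (by omega)
      rw [Nat.sub_add_cancel hK] at this
      exact this.trans (max_le hRT (le_max_right _ _))
    have one_le : (1 : ℝ) ≤ (n + 1).factorial * 4 ^ (n + 1) :=
      mod_cast Nat.mul_pos (Nat.factorial_pos _) (by positivity)
    calc _ ≤ 2 + 2 * (n + 1).factorial * 4 ^ (n + 1) * (R ^ (n + 2) / lam ^ (n + 1)) :=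
          norm_iteratedFDeriv_cTransform_le hlam hμ hφ n y
      _ ≤ 2 * ((n + 1).factorial * 4 ^ (n + 1)) * T +
          2 * (n + 1).factorial * 4 ^ (n + 1) * T := by
          gcongr
          nlinarith
      _ = 4 ^ (n + 2) * (n + 1).factorial * T := by ring
      _ ≤ 4 ^ K * K.factorial * T := by
          gcongr <;> first | omega | norm_num

theorem ckNorm_le_of_eqOn_cTransform (hR : 0 < R) (hlam : 0 < lam) (hμ : ∀ᵐ x ∂μ, ‖x‖ ≤ R)
    (hφ : Integrable (fun x => Real.exp (φ x / lam)) μ) (h0 : ψ 0 = 0)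
    (hψ : Set.EqOn ψ (cTransform lam μ φ) (closedBall 0 R)) (hK : 1 ≤ K)
    (h : K = 1 ∨ min 1 lam ≤ R ^ 2) :
    ckNorm (closedBall 0 R) K ψ ≤
      ENNReal.ofReal (4 ^ K * K.factorial * max (R ^ 2) (R ^ K / lam ^ (K - 1))) := by
  have smooth : ContDiff ℝ ∞ (cTransform lam μ φ) := contDiff_cTransform hlam hμ hφ
  have uniqueDiff : UniqueDiffOn ℝ (closedBall (0 : EuclideanSpace ℝ (Fin d)) R) :=
    uniqueDiffOn_convex (convex_closedBall _ _) ⟨0, ball_subset_interior_closedBall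
      (mem_ball_self hR)⟩
  refine ckNorm_le uniqueDiff (smooth.contDiffOn.congr hψ) fun n hn y hy => ?_
  rw [iteratedFDerivWithin_congr hψ hy, iteratedFDerivWithin_eq_iteratedFDeriv uniqueDiff
    (smooth.contDiffAt.of_le (mod_cast le_top)) hy]
  exact norm_iteratedFDeriv_cTransform_le_max hR hlam hμ hφ
    ((hψ (mem_closedBall_self hR.le)).symm.trans h0) h hK hn (mem_closedBall_zero_iff.1 hy)

end Bounds

section CTransformOrder

variable {d : ℕ} {lam ε : ℝ} {μ : Measure (EuclideanSpace ℝ (Fin d))}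
  {f g φ : EuclideanSpace ℝ (Fin d) → ℝ}

theorem cTransform_congr_ae (h : f =ᵐ[μ] g) : cTransform lam μ f = cTransform lam μ g := by
  ext y
  rw [cTransform, cTransform, integral_congr_ae]
  filter_upwards [h] with x hx
  rw [hx]

variable [NeZero μ]

theorem exp_neg_cTransform_div (hlam : 0 < lam) (hφ : Integrable (fun x => Real.exp (φ x / lam)) μ)
    (y : EuclideanSpace ℝ (Fin d)) : Real.exp (-cTransform lam μ φ y / lam) =
      ∫ x, Real.exp (-(‖x - y‖ ^ 2 - φ x) / lam) ∂μ := by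
  rw [cTransform, neg_mul, neg_neg, mul_div_cancel_left₀ _ hlam.ne',
    Real.exp_log (integral_exp_pos (integrable_exp_cost hlam hφ y))]

theorem cTransform_add_const (hlam : 0 < lam) (hφ : Integrable (fun x => Real.exp (φ x / lam)) μ)
    (a : ℝ) : cTransform lam μ (fun x => φ x + a) = fun y => cTransform lam μ φ y - a := by
  ext y
  have factor (x : EuclideanSpace ℝ (Fin d)) : Real.exp (-(‖x - y‖ ^ 2 - (φ x + a)) / lam) =
      Real.exp (-(‖x - y‖ ^ 2 - φ x) / lam) * Real.exp (a / lam) := by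
    rw [← Real.exp_add]
    ring_nf
  simp_rw [cTransform, factor, integral_mul_const]
  rw [Real.log_mul (integral_exp_pos (integrable_exp_cost hlam hφ y)).ne' (Real.exp_ne_zero _),
    Real.log_exp, mul_add, neg_mul lam (a / lam), mul_div_cancel₀ a hlam.ne', sub_eq_add_neg]

theorem cTransform_anti (hlam : 0 < lam) (hf : Integrable (fun x => Real.exp (f x / lam)) μ)
    (hg : Integrable (fun x => Real.exp (g x / lam)) μ) (h : f ≤ᵐ[μ] g) :
    cTransform lam μ g ≤ cTransform lam μ f := fun y => by
  refine mul_le_mul_of_nonpos_left (Real.log_le_log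
    (integral_exp_pos (integrable_exp_cost hlam hf y)) (integral_mono_ae
      (integrable_exp_cost hlam hf y) (integrable_exp_cost hlam hg y) ?_)) (neg_nonpos.2 hlam.le)
  filter_upwards [h] with x hx
  gcongr

theorem cTransform_sub_cTransform_le (hlam : 0 < lam)
    (hf : Integrable (fun x => Real.exp (f x / lam)) μ)
    (hg : Integrable (fun x => Real.exp (g x / lam)) μ) (h : ∀ᵐ x ∂μ, g x ≤ f x + ε)
    (y : EuclideanSpace ℝ (Fin d)) : cTransform lam μ f y - cTransform lam μ g y ≤ ε := by
  have hfε : Integrable (fun x => Real.exp ((f x + ε) / lam)) μ := by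
    simpa only [add_div, Real.exp_add] using hf.mul_const _
  have anti := cTransform_anti hlam hg hfε h y
  rw [cTransform_add_const hlam hf] at anti
  exact sub_le_comm.1 anti

theorem abs_cTransform_sub_cTransform_le (hlam : 0 < lam)
    (hf : Integrable (fun x => Real.exp (f x / lam)) μ)
    (hg : Integrable (fun x => Real.exp (g x / lam)) μ) (h : ∀ᵐ x ∂μ, |f x - g x| ≤ ε)
    (y : EuclideanSpace ℝ (Fin d)) : |cTransform lam μ f y - cTransform lam μ g y| ≤ ε := by
  refine abs_sub_le_iff.2 ⟨cTransform_sub_cTransform_le hlam hf hg ?_ y,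
    cTransform_sub_cTransform_le hlam hg hf ?_ y⟩ <;>
  · filter_upwards [h] with x hx
    linarith [abs_sub_le_iff.1 hx]

end CTransformOrder

section BoundedPotentials

theorem integrable_exp_div_of_memLp_top {Ω : Type*} [MeasurableSpace Ω] {μ : Measure Ω}
    [IsFiniteMeasure μ] {φ : Ω → ℝ} (hφ : MemLp φ ∞ μ) (lam : ℝ) :
    Integrable (fun x => Real.exp (φ x / lam)) μ := by
  refine .of_bound (Real.continuous_exp.comp_aestronglyMeasurable
    (hφ.aemeasurable.div_const lam).aestronglyMeasurable) (Real.exp (lpNorm φ ∞ μ / |lam|)) ?_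
  filter_upwards [ae_le_lpNorm_exponent_top hφ] with x hx
  rw [Real.norm_of_nonneg (Real.exp_pos _).le, Real.exp_le_exp]
  calc φ x / lam ≤ |φ x| / |lam| := (le_abs_self _).trans_eq (abs_div _ _)
    _ ≤ lpNorm φ ∞ μ / |lam| := by gcongr; exact hx

theorem abs_integral_sub_integral_le {Ω : Type*} [MeasurableSpace Ω] {ρ : Measure Ω}
    [IsProbabilityMeasure ρ] {u v : Ω → ℝ} {ε : ℝ} (hu : Integrable u ρ) (hv : Integrable v ρ)
    (h : ∀ᵐ x ∂ρ, |u x - v x| ≤ ε) : |∫ x, u x ∂ρ - ∫ x, v x ∂ρ| ≤ ε := by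
  rw [← integral_sub hu hv]
  simpa using norm_integral_le_of_norm_le_const (f := fun x => u x - v x) h

theorem memLp_top_of_ae_mem_isCompact {X : Type*} [TopologicalSpace X] [MeasurableSpace X]
    [OpensMeasurableSpace X] {μ : Measure X} {K : Set X} {f : X → ℝ} (hK : IsCompact K)
    (hμ : ∀ᵐ x ∂μ, x ∈ K) (hf : Continuous f) : MemLp f ∞ μ := by
  obtain ⟨C, hC⟩ := hK.exists_bound_of_continuousOn hf.continuousOn
  exact memLp_top_of_bound hf.aestronglyMeasurable C (hμ.mono hC)

variable {d : ℕ} {R lam : ℝ} {μ ν : Measure (EuclideanSpace ℝ (Fin d))}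
  {φ : EuclideanSpace ℝ (Fin d) → ℝ}

theorem memLp_top_of_ae_norm_le (hμ : ∀ᵐ x ∂μ, ‖x‖ ≤ R) (hφ : Continuous φ) : MemLp φ ∞ μ :=
  memLp_top_of_ae_mem_isCompact (isCompact_closedBall 0 R)
    (hμ.mono fun _ => mem_closedBall_zero_iff.2) hφ

theorem memLp_cTransform [NeZero μ] (hlam : 0 < lam) (hμ : ∀ᵐ x ∂μ, ‖x‖ ≤ R)
    (hν : ∀ᵐ x ∂ν, ‖x‖ ≤ R) (hφ : Integrable (fun x => Real.exp (φ x / lam)) μ) :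
    MemLp (cTransform lam μ φ) ∞ ν :=
  memLp_top_of_ae_norm_le hν (contDiff_cTransform hlam hμ hφ).continuous

end BoundedPotentials

section Duality

variable {d : ℕ} {R lam ε : ℝ} {μ ν : Measure (EuclideanSpace ℝ (Fin d))}
  {f g : EuclideanSpace ℝ (Fin d) → ℝ}

/-- The semi-dual objective of entropic optimal transport: the maximum of the dual objective over
its first variable, which is attained at the `c`-transform of the second one. -/
noncomputable def semiDual (lam : ℝ) (μ ν : Measure (EuclideanSpace ℝ (Fin d)))
    (g : EuclideanSpace ℝ (Fin d) → ℝ) : ℝ :=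
  ∫ x, cTransform lam ν g x ∂μ + ∫ y, g y ∂ν

theorem semiDual_congr_ae (h : f =ᵐ[ν] g) : semiDual lam μ ν f = semiDual lam μ ν g := by
  rw [semiDual, semiDual, cTransform_congr_ae h, integral_congr_ae h]

theorem dualObjective_swap [SFinite μ] [SFinite ν] :
    dualObjective lam ν μ g f = dualObjective lam μ ν f g := by
  rw [dualObjective, dualObjective, ← integral_prod_swap, add_comm (∫ x, f x ∂μ)]
  simp only [Prod.fst_swap, Prod.snd_swap, add_comm (f _), norm_sub_rev]

theorem integrable_exp_dual [SFinite μ] [SFinite ν] (hlam : 0 < lam)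
    (hf : Integrable (fun x => Real.exp (f x / lam)) μ)
    (hg : Integrable (fun y => Real.exp (g y / lam)) ν) :
    Integrable (fun z : EuclideanSpace ℝ (Fin d) × EuclideanSpace ℝ (Fin d) =>
      Real.exp ((f z.1 + g z.2 - ‖z.1 - z.2‖ ^ 2) / lam)) (μ.prod ν) := by
  have factor (z : EuclideanSpace ℝ (Fin d) × EuclideanSpace ℝ (Fin d)) :
      Real.exp ((f z.1 + g z.2 - ‖z.1 - z.2‖ ^ 2) / lam) =
        Real.exp (-‖z.1 - z.2‖ ^ 2 / lam) * (Real.exp (f z.1 / lam) * Real.exp (g z.2 / lam)) := by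
    rw [← Real.exp_add, ← Real.exp_add]
    ring_nf
  simp_rw [factor]
  refine (hf.mul_prod hg).bdd_mul (c := 1) (by fun_prop) (.of_forall fun z => ?_)
  rw [Real.norm_of_nonneg (Real.exp_pos _).le, Real.exp_le_one_iff, neg_div, neg_nonpos]
  positivity

theorem integral_exp_dual [NeZero ν] (hlam : 0 < lam)
    (hg : Integrable (fun y => Real.exp (g y / lam)) ν) (a : ℝ) (x : EuclideanSpace ℝ (Fin d)) :
    ∫ y, Real.exp ((a + g y - ‖x - y‖ ^ 2) / lam) ∂ν =
      Real.exp ((a - cTransform lam ν g x) / lam) := by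
  have factor (y : EuclideanSpace ℝ (Fin d)) : Real.exp ((a + g y - ‖x - y‖ ^ 2) / lam) =
      Real.exp (a / lam) * Real.exp (-(‖y - x‖ ^ 2 - g y) / lam) := by
    rw [← Real.exp_add, norm_sub_rev]
    ring_nf
  simp_rw [factor]
  rw [integral_const_mul, ← exp_neg_cTransform_div hlam hg, ← Real.exp_add, ← add_div,
    sub_eq_add_neg]

variable [IsProbabilityMeasure μ] [IsProbabilityMeasure ν]

theorem dualObjective_add_sub (hf : Integrable f μ) (hg : Integrable g ν) (a : ℝ) :
    dualObjective lam μ ν (fun x => f x + a) (fun y => g y - a) = dualObjective lam μ ν f g := by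
  rw [dualObjective, dualObjective, integral_add hf (integrable_const a),
    integral_sub hg (integrable_const a)]
  simp only [integral_const, probReal_univ, smul_eq_mul, one_mul, add_add_sub_cancel]

theorem dualObjective_eq (hlam : 0 < lam) (hf : Integrable (fun x => Real.exp (f x / lam)) μ)
    (hg : Integrable (fun y => Real.exp (g y / lam)) ν) :
    dualObjective lam μ ν f g = ∫ x, f x ∂μ + ∫ y, g y ∂ν -
      lam * (∫ x, Real.exp ((f x - cTransform lam ν g x) / lam) ∂μ - 1) := by
  have hexp := integrable_exp_dual hlam hf hg
  rw [dualObjective, integral_const_mul, integral_sub hexp (integrable_const 1),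
    integral_prod _ hexp]
  simp only [integral_exp_dual hlam hg, integral_const, probReal_univ, one_smul]

theorem dualObjective_cTransform_left (hlam : 0 < lam) (hμ : ∀ᵐ x ∂μ, ‖x‖ ≤ R)
    (hν : ∀ᵐ x ∂ν, ‖x‖ ≤ R) (hg : Integrable (fun y => Real.exp (g y / lam)) ν) :
    dualObjective lam μ ν (cTransform lam ν g) g = semiDual lam μ ν g := by
  rw [dualObjective_eq hlam (integrable_exp_div_of_memLp_top
    (memLp_cTransform hlam hν hμ hg) lam) hg, semiDual]
  simp

theorem dualObjective_le_semiDual (hlam : 0 < lam) (hμ : ∀ᵐ x ∂μ, ‖x‖ ≤ R)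
    (hν : ∀ᵐ x ∂ν, ‖x‖ ≤ R) (hf : MemLp f ∞ μ)
    (hg : Integrable (fun y => Real.exp (g y / lam)) ν) :
    dualObjective lam μ ν f g ≤ semiDual lam μ ν g := by
  have hc := memLp_cTransform hlam hν hμ hg
  have hexp := integrable_exp_div_of_memLp_top (hf.sub hc) lam
  have hint : Integrable (fun x => (f x - cTransform lam ν g x) / lam) μ :=
    ((hf.sub hc).integrable le_top).div_const lam
  have add_one_le : ∫ x, (f x - cTransform lam ν g x) / lam ∂μ + 1 ≤
      ∫ x, Real.exp ((f x - cTransform lam ν g x) / lam) ∂μ := by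
    calc _ = ∫ x, ((f x - cTransform lam ν g x) / lam + 1) ∂μ := by
          simp [integral_add hint (integrable_const 1)]
      _ ≤ _ := integral_mono (hint.add (integrable_const 1)) hexp fun x => Real.add_one_le_exp _
  rw [integral_div, integral_sub (hf.integrable le_top) (hc.integrable le_top),
    div_add_one hlam.ne', div_le_iff₀ hlam] at add_one_le
  rw [dualObjective_eq hlam (integrable_exp_div_of_memLp_top hf lam) hg, semiDual]
  linarith

theorem dualObjective_le_cTransform_right (hlam : 0 < lam) (hμ : ∀ᵐ x ∂μ, ‖x‖ ≤ R)
    (hν : ∀ᵐ x ∂ν, ‖x‖ ≤ R) (hf : Integrable (fun x => Real.exp (f x / lam)) μ)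
    (hg : MemLp g ∞ ν) :
    dualObjective lam μ ν f g ≤ dualObjective lam μ ν f (cTransform lam μ f) := by
  rw [← dualObjective_swap, ← dualObjective_swap (g := cTransform lam μ f),
    dualObjective_cTransform_left hlam hν hμ hf]
  exact dualObjective_le_semiDual hlam hν hμ hg hf

theorem semiDual_le_dualObjective_cTransform (hlam : 0 < lam) (hμ : ∀ᵐ x ∂μ, ‖x‖ ≤ R)
    (hν : ∀ᵐ x ∂ν, ‖x‖ ≤ R) (hg : MemLp g ∞ ν) :
    semiDual lam μ ν g ≤ dualObjective lam μ ν (cTransform lam ν g)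
      (cTransform lam μ (cTransform lam ν g)) := by
  have hexp := integrable_exp_div_of_memLp_top hg lam
  rw [← dualObjective_cTransform_left hlam hμ hν hexp]
  exact dualObjective_le_cTransform_right hlam hμ hν (integrable_exp_div_of_memLp_top
    (memLp_cTransform hlam hν hμ hexp) lam) hg

theorem semiDual_sub_const (hlam : 0 < lam) (hμ : ∀ᵐ x ∂μ, ‖x‖ ≤ R) (hν : ∀ᵐ x ∂ν, ‖x‖ ≤ R)
    (hg : MemLp g ∞ ν) (a : ℝ) : semiDual lam μ ν (fun y => g y - a) = semiDual lam μ ν g := by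
  have hexp := integrable_exp_div_of_memLp_top hg lam
  simp only [semiDual, sub_eq_add_neg, cTransform_add_const hlam hexp]
  rw [integral_add ((memLp_cTransform hlam hν hμ hexp).integrable le_top) (integrable_const _),
    integral_add (hg.integrable le_top) (integrable_const _)]
  simp only [integral_const, probReal_univ, one_smul]
  ring

theorem abs_semiDual_sub_semiDual_le (hlam : 0 < lam) (hμ : ∀ᵐ x ∂μ, ‖x‖ ≤ R)
    (hν : ∀ᵐ x ∂ν, ‖x‖ ≤ R) (hf : MemLp f ∞ ν) (hg : MemLp g ∞ ν)
    (h : ∀ᵐ x ∂ν, |f x - g x| ≤ ε) : |semiDual lam μ ν f - semiDual lam μ ν g| ≤ ε + ε := by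
  have hf' := integrable_exp_div_of_memLp_top hf lam
  have hg' := integrable_exp_div_of_memLp_top hg lam
  rw [semiDual, semiDual, add_sub_add_comm]
  refine (abs_add_le _ _).trans (add_le_add ?_
    (abs_integral_sub_integral_le (hf.integrable le_top) (hg.integrable le_top) h))
  exact abs_integral_sub_integral_le ((memLp_cTransform hlam hν hμ hf').integrable le_top)
    ((memLp_cTransform hlam hν hμ hg').integrable le_top)
    (.of_forall (abs_cTransform_sub_cTransform_le hlam hf' hg' h))

end Duality

section Existence

theorem isCompact_setOf_lipschitzWith_of_apply_eq {X Y : Type*} [PseudoMetricSpace X]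
    [MetricSpace Y] [ProperSpace Y] (x₀ : X) (y₀ : Y) (C : NNReal) :
    IsCompact {u : C(X, Y) | u x₀ = y₀ ∧ LipschitzWith C u} := by
  have image_eq : ContinuousMap.toFun '' {u : C(X, Y) | u x₀ = y₀ ∧ LipschitzWith C u} =
      {u : X → Y | u x₀ = y₀} ∩ {u | LipschitzWith C u} :=
    Set.ext fun u => ⟨by rintro ⟨u, hu, rfl⟩; exact hu, fun hu => ⟨⟨u, hu.2.continuous⟩, hu, rfl⟩⟩
  have closed : IsClosed ({u : X → Y | u x₀ = y₀} ∩ {u | LipschitzWith C u}) :=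
    (isClosed_eq (continuous_apply x₀) continuous_const).inter (isClosed_setOfPred_lipschitzWith C)
  refine ArzelaAscoli.isCompact_of_equicontinuous _ ?_
    (LipschitzWith.uniformEquicontinuous _ C fun u => u.2.2).equicontinuous
  rw [image_eq]
  refine (isCompact_univ_pi fun x => isCompact_closedBall y₀ (C * dist x x₀)).of_isClosed_subset
    closed ?_
  rintro u ⟨rfl, hu⟩ x -
  exact hu.dist_le_mul x x₀

variable {d : ℕ} {R lam : ℝ} {μ ν : Measure (EuclideanSpace ℝ (Fin d))}
  [IsProbabilityMeasure μ] [IsProbabilityMeasure ν]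

theorem continuous_semiDual (hlam : 0 < lam) (hμ : ∀ᵐ x ∂μ, ‖x‖ ≤ R) (hν : ∀ᵐ x ∂ν, ‖x‖ ≤ R) :
    Continuous fun u : C(EuclideanSpace ℝ (Fin d), ℝ) => semiDual lam μ ν u := by
  refine continuous_iff_continuousAt.2 fun u => Metric.tendsto_nhds.2 fun ε hε => ?_
  have uniform := Metric.tendstoUniformlyOn_iff.1
    (ContinuousMap.tendsto_iff_forall_isCompact_tendstoUniformlyOn.1
      (Filter.tendsto_id (x := nhds u)) (closedBall 0 R) (isCompact_closedBall 0 R))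
    (ε / 3) (by positivity)
  filter_upwards [uniform] with v hv
  have close : ∀ᵐ x ∂ν, |v x - u x| ≤ ε / 3 := by
    filter_upwards [hν] with x hx
    rw [← Real.dist_eq, dist_comm]
    exact (hv x (mem_closedBall_zero_iff.2 hx)).le
  have bound := abs_semiDual_sub_semiDual_le hlam hμ hν
    (memLp_top_of_ae_norm_le hν v.continuous) (memLp_top_of_ae_norm_le hν u.continuous) close
  rw [Real.dist_eq]
  linarith

theorem exists_lipschitzWith_semiDual_ge (hlam : 0 < lam) (hR : 0 < R) (hμ : ∀ᵐ x ∂μ, ‖x‖ ≤ R)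
    (hν : ∀ᵐ x ∂ν, ‖x‖ ≤ R) {g : EuclideanSpace ℝ (Fin d) → ℝ} (hg : MemLp g ∞ ν) :
    ∃ u : C(EuclideanSpace ℝ (Fin d), ℝ), (u 0 = 0 ∧ LipschitzWith (4 * R).toNNReal u) ∧
      semiDual lam μ ν g ≤ semiDual lam μ ν u := by
  set φ := cTransform lam ν g
  set ψ := cTransform lam μ φ
  have hφ : MemLp φ ∞ μ := memLp_cTransform hlam hν hμ (integrable_exp_div_of_memLp_top hg lam)
  have hφ' := integrable_exp_div_of_memLp_top hφ lam
  have hψ : MemLp ψ ∞ ν := memLp_cTransform hlam hμ hν hφ'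
  have lipschitz : LipschitzOnWith (4 * R).toNNReal (fun y => ψ y - ψ 0) (closedBall 0 R) := by
    simpa [ψ, LipschitzOnWith] using lipschitzOnWith_cTransform hlam hμ hφ'
  obtain ⟨u, hu, hψu⟩ := lipschitz.extend_real
  refine ⟨⟨u, hu.continuous⟩, ⟨?_, hu⟩, ?_⟩
  · simpa using (hψu (mem_closedBall_self hR.le)).symm
  calc semiDual lam μ ν g ≤ dualObjective lam μ ν φ ψ :=
        semiDual_le_dualObjective_cTransform hlam hμ hν hg
    _ ≤ semiDual lam μ ν ψ :=
        dualObjective_le_semiDual hlam hμ hν hφ (integrable_exp_div_of_memLp_top hψ lam)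
    _ = semiDual lam μ ν (fun y => ψ y - ψ 0) := (semiDual_sub_const hlam hμ hν hψ _).symm
    _ = semiDual lam μ ν u :=
        semiDual_congr_ae (hν.mono fun y hy => hψu (mem_closedBall_zero_iff.2 hy))

theorem exists_forall_semiDual_le (hlam : 0 < lam) (hR : 0 < R) (hμ : ∀ᵐ x ∂μ, ‖x‖ ≤ R)
    (hν : ∀ᵐ x ∂ν, ‖x‖ ≤ R) : ∃ g : EuclideanSpace ℝ (Fin d) → ℝ, MemLp g ∞ ν ∧
      ∀ h : EuclideanSpace ℝ (Fin d) → ℝ, MemLp h ∞ ν →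
        semiDual lam μ ν h ≤ semiDual lam μ ν g := by
  obtain ⟨u, -, hu⟩ := (isCompact_setOf_lipschitzWith_of_apply_eq
    (0 : EuclideanSpace ℝ (Fin d)) (0 : ℝ) (4 * R).toNNReal).exists_isMaxOn
      ⟨0, rfl, (LipschitzWith.const 0).weaken zero_le⟩
      (continuous_semiDual hlam hμ hν).continuousOn
  refine ⟨u, memLp_top_of_ae_norm_le hν u.continuous, fun h hh => ?_⟩
  obtain ⟨v, hv, hle⟩ := exists_lipschitzWith_semiDual_ge hlam hR hμ hν hh
  exact hle.trans (hu hv)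

theorem exists_isDualPotentials (hlam : 0 < lam) (hR : 0 < R) (hμ : ∀ᵐ x ∂μ, ‖x‖ ≤ R)
    (hν : ∀ᵐ x ∂ν, ‖x‖ ≤ R) : ∃ φ ψ : EuclideanSpace ℝ (Fin d) → ℝ,
      IsDualPotentials lam μ ν φ ψ ∧ ψ 0 = 0 ∧ ψ = cTransform lam μ φ := by
  obtain ⟨g, hg, hmax⟩ := exists_forall_semiDual_le hlam hR hμ hν
  set φ := cTransform lam ν g
  set ψ := cTransform lam μ φ
  have hφ : MemLp φ ∞ μ := memLp_cTransform hlam hν hμ (integrable_exp_div_of_memLp_top hg lam)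
  have hφ' := integrable_exp_div_of_memLp_top hφ lam
  have hψ : MemLp ψ ∞ ν := memLp_cTransform hlam hμ hν hφ'
  refine ⟨fun x => φ x + ψ 0, fun y => ψ y - ψ 0, ⟨hφ.add (memLp_const _), hψ.sub (memLp_const _),
    fun f h hf hh => ?_⟩, sub_self _, (cTransform_add_const hlam hφ' _).symm⟩
  calc dualObjective lam μ ν f h ≤ semiDual lam μ ν h :=
        dualObjective_le_semiDual hlam hμ hν hf (integrable_exp_div_of_memLp_top hh lam)
    _ ≤ semiDual lam μ ν g := hmax h hh
    _ ≤ dualObjective lam μ ν φ ψ := semiDual_le_dualObjective_cTransform hlam hμ hν hg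
    _ = dualObjective lam μ ν (fun x => φ x + ψ 0) (fun y => ψ y - ψ 0) :=
        (dualObjective_add_sub (hφ.integrable le_top) (hψ.integrable le_top) _).symm

end Existence

section Mixture

variable {d m : ℕ} {R : ℝ} {μ : Fin m → Measure (EuclideanSpace ℝ (Fin d))} {θ : Fin m → ℝ}

theorem ae_norm_le_of_support_subset {ν : Measure (EuclideanSpace ℝ (Fin d))}
    (h : ν.support ⊆ closedBall 0 R) : ∀ᵐ x ∂ν, ‖x‖ ≤ R := by
  filter_upwards [ν.support_mem_ae] with x hx using mem_closedBall_zero_iff.1 (h hx)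

theorem isProbabilityMeasure_mixture [∀ k, IsProbabilityMeasure (μ k)]
    (hθ : θ ∈ stdSimplex ℝ (Fin m)) : IsProbabilityMeasure (mixture μ θ) := by
  refine ⟨?_⟩
  simp only [mixture, Measure.coe_finsetSum, Finset.sum_apply, Measure.smul_apply, measure_univ,
    smul_eq_mul, mul_one]
  rw [← ENNReal.ofReal_sum_of_nonneg fun k _ => hθ.1 k, hθ.2, ENNReal.ofReal_one]

theorem ae_mixture {p : EuclideanSpace ℝ (Fin d) → Prop} (h : ∀ k, ∀ᵐ x ∂μ k, p x) :
    ∀ᵐ x ∂mixture μ θ, p x := by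
  simp only [ae_iff, mixture, Measure.coe_finsetSum, Finset.sum_apply, Measure.smul_apply,
    smul_eq_mul] at h ⊢
  exact Finset.sum_eq_zero fun k _ => by rw [h k, mul_zero]

end Mixture

end EntropicOT

theorem mainTheorem8_general {d : ℕ} {R lam : ℝ} (hR : 0 < R) (hlam : 0 < lam)
    {μ ν : Measure (EuclideanSpace ℝ (Fin d))} [IsProbabilityMeasure μ] [IsProbabilityMeasure ν]
    (hμ : ∀ᵐ x ∂μ, ‖x‖ ≤ R) (hν : ∀ᵐ x ∂ν, ‖x‖ ≤ R) :
    (∃ φ ψ : EuclideanSpace ℝ (Fin d) → ℝ, EntropicOT.IsDualPotentials lam μ ν φ ψ ∧ ψ 0 = 0 ∧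
      ψ = EntropicOT.cTransform lam μ φ) ∧
    ∀ φ ψ : EuclideanSpace ℝ (Fin d) → ℝ, Integrable (fun x => Real.exp (φ x / lam)) μ →
      ψ 0 = 0 → Set.EqOn ψ (EntropicOT.cTransform lam μ φ) (closedBall 0 R) →
      ContDiffOn ℝ ∞ ψ (closedBall 0 R) ∧
      ∀ K : ℕ, 1 ≤ K → (K = 1 ∨ min 1 lam ≤ R ^ 2) →
        EntropicOT.ckNorm (closedBall 0 R) K ψ ≤
          ENNReal.ofReal (4 ^ K * K.factorial * max (R ^ 2) (R ^ K / lam ^ (K - 1))) :=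
  ⟨EntropicOT.exists_isDualPotentials hlam hR hμ hν, fun _φ _ψ hφ h0 hψ =>
    ⟨(EntropicOT.contDiff_cTransform hlam hμ hφ).contDiffOn.congr hψ, fun _K hK h =>
      EntropicOT.ckNorm_le_of_eqOn_cTransform hR hlam hμ hφ h0 hψ hK h⟩⟩

theorem mainTheorem8 :
    ∃ M : ℕ → ℝ, (∀ K, 0 < M K) ∧
      ∀ (d m : ℕ) (R lam : ℝ), 0 < R → 0 < lam →
      ∀ (μ : Fin m → Measure (EuclideanSpace ℝ (Fin d)))
        (ν : Measure (EuclideanSpace ℝ (Fin d))),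
        (∀ k, IsProbabilityMeasure (μ k)) → IsProbabilityMeasure ν →
        (∀ k, (μ k).support ⊆ closedBall 0 R) → ν.support ⊆ closedBall 0 R →
      ∀ θ ∈ stdSimplex ℝ (Fin m),
        (∃ φ ψ : EuclideanSpace ℝ (Fin d) → ℝ,
          EntropicOT.IsDualPotentials lam (EntropicOT.mixture μ θ) ν φ ψ ∧ ψ 0 = 0 ∧
          ∀ y ∈ closedBall 0 R,
            ψ y = EntropicOT.cTransform lam (EntropicOT.mixture μ θ) φ y) ∧
        ∀ φ ψ : EuclideanSpace ℝ (Fin d) → ℝ,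
          EntropicOT.IsDualPotentials lam (EntropicOT.mixture μ θ) ν φ ψ → ψ 0 = 0 →
          (∀ y ∈ closedBall 0 R,
            ψ y = EntropicOT.cTransform lam (EntropicOT.mixture μ θ) φ y) →
          ContDiffOn ℝ ∞ ψ (closedBall 0 R) ∧
          ∀ K : ℕ, 1 ≤ K → (K = 1 ∨ min 1 lam ≤ R ^ 2) →
            EntropicOT.ckNorm (closedBall 0 R) K ψ
              ≤ ENNReal.ofReal (M K * max (R ^ 2) (R ^ K / lam ^ (K - 1))) := by
  refine ⟨fun K => 4 ^ K * K.factorial, fun K => by positivity, ?_⟩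
  intro d m R lam hR hlam μ ν hμ hν hμR hνR θ hθ
  have := EntropicOT.isProbabilityMeasure_mixture hθ (μ := μ)
  have ⟨⟨φ, ψ, hpot, h0, hψ⟩, hbound⟩ := mainTheorem8_general hR hlam
    (EntropicOT.ae_mixture (θ := θ) fun k => EntropicOT.ae_norm_le_of_support_subset (hμR k))
    (EntropicOT.ae_norm_le_of_support_subset hνR)
  exact ⟨⟨φ, ψ, hpot, h0, fun y _ => congrFun hψ y⟩, fun φ ψ hpot => hbound φ ψ
    (EntropicOT.integrable_exp_div_of_memLp_top hpot.memLp_left lam)⟩
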